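/- Let $K$ be a field of characteristic zero (for example $\mathbb R$ or $\mathbb C$) and let $V$ be a finite-dimensional vector space over $K$ with basis $e_1,\dots,e_N$. A triple system on $V$ is a trilinear map $V^3\to V$, a 5-system is a 5-linear map $V^5\to V$. A Jordan triple system is a triple system $[\cdot,\cdot,\cdot]$ with $[x,y,z]=[z,y,x]$ and $$[x,y,[u,v,z]]-[[x,y,u],v,z]-[u,v,[x,y,z]]+[u,[y,x,v],z]=0$$ for all $x,y,u,v,z\in V$. Let $\mathcal F=K[u^i_k : 1\le i\le N,\ k\ge 0]$ be the ring of differential polynomials, with the derivation $D=\sum_{i,k}u^i_{k+1}\,\partial/\partial u^i_k$, and put $U_k=\sum_i u^i_k e_i$, $U=U_0$, $U_x=U_1$, $U_{xxx}=U_3$. An evolution system $U_\tau=G=\sum_i G^i e_i$ with $G^i\in\mathcal F$ is a symmetry of the evolution system $U_t=F=\sum_iF^ie_i$ with $F^i\in\mathcal F$ if the vector fields $D_F=\sum_{i,k}D^k(F^i)\,\partial/\partial u^i_k$ and $D_G=\sum_{i,k}D^k(G^i)\,\partial/\partial u^i_k$ commute. For a triple system $B$ consider the system $$U_t=U_{xxx}+3B(U,U_x,U)\qquad(1)$$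 and symmetries of (1) of the form $$U_\tau=U_5+5B_1(U,U,U_3)+5B_2(U,U_1,U_2)+5B_3(U_1,U_1,U_1)+5C(U,U,U,U,U_1),\qquad(2)$$ where $B_1,B_2,B_3$ are triple systems and $C$ is a 5-system. 1. Let $B$ satisfy $B(x,y,z)=B(z,y,x)$ for all $x,y,z\in V$. Then (1) has a symmetry of the form (2) for some $B_1,B_2,B_3,C$ if and only if there is a Jordan triple system $[\cdot,\cdot,\cdot]$ on $V$ such that $$B(x,y,z)=[x,z,y]+[z,x,y]\qquad\text{for all }x,y,z\in V.\qquad(3)$$ 2. For every Jordan triple system $[\cdot,\cdot,\cdot]$ on $V$ there is exactly one triple system $B$ with $B(x,y,z)=B(z,y,x)$ and $B(x,y,x)=[x,x,y]$ for all $x,y,z\in V$; and for every triple system $B$ with $B(x,y,x)=[x,x,y]$ for all $x,y\in V$, system (1) has a symmetry of the form (2) for some $B_1,B_2,B_3,C$. 3. Let $B$ satisfy $B(x,y,z)=B(z,y,x)$ for all $x,y,z\in V$, and let $B_1,B_2,B_3$ be triple systems and $C$ a 5-system on $V$. Then (2) is a symmetry of (1) if and only if (3) holds for some Jordan triple system $[\cdot,\cdot,\cdot]$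 on $V$ and, for all $x,y,z\in V$, $$B_1(x,x,y)=B(x,y,x),\qquad B_2(x,y,z)=2B(x,y,z)+2B(x,z,y),\qquad B_3(x,x,x)=B(x,x,x),$$ $$C(x,x,x,x,y)=B(x,B(x,y,x),x)+\tfrac12 B(x,y,B(x,x,x)).$$ -/

import Mathlib

open Module

/-- A triple system on `V`: a trilinear operation `V × V × V → V`. -/
abbrev TripleSystem (K V : Type*) [Field K] [AddCommGroup V] [Module K V] :=
  V →ₗ[K] V →ₗ[K] V →ₗ[K] V

/-- A 5-system on `V`: a 5-linear operation on `V` with values in `V`. -/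
abbrev FiveSystem (K V : Type*) [Field K] [AddCommGroup V] [Module K V] :=
  V →ₗ[K] V →ₗ[K] V →ₗ[K] V →ₗ[K] V →ₗ[K] V

/-- Symmetry of a triple system in its outer arguments: `B(x,y,z) = B(z,y,x)`. -/
def IsOuterSymmetric {K V : Type*} [Field K] [AddCommGroup V] [Module K V]
    (B : TripleSystem K V) : Prop :=
  ∀ x y z : V, B x y z = B z y x

/-- Jordan triple systems. -/
structure IsJordanTriple {K V : Type*} [Field K] [AddCommGroup V] [Module K V]
    (T : TripleSystem K V) : Prop where
  symm : IsOuterSymmetric T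
  jordan : ∀ x y u v z : V,
    T x y (T u v z) - T (T x y u) v z - T u v (T x y z) + T u (T y x v) z = 0

/-- The ring of differential polynomials in `u^i`, `i ∈ ι`; the variable `(i, k)` is the
`k`-th `x`-derivative `u^i_k` of `u^i`. -/
abbrev DiffPoly (ι K : Type*) [Field K] := MvPolynomial (ι × ℕ) K

namespace DiffPoly

noncomputable section

/-- The vector `U_k = (u^i_k)_i` of `k`-th derivatives. -/
def U (ι K : Type*) [Field K] (k : ℕ) : ι → DiffPoly ι K :=
  fun i => MvPolynomial.X (i, k)

/-- The total `x`-derivative `D = ∑ u^i_{k+1} ∂/∂u^i_k`. -/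
def totalD (ι K : Type*) [Field K] : Derivation K (DiffPoly ι K) (DiffPoly ι K) :=
  MvPolynomial.mkDerivation K (fun p : ι × ℕ => MvPolynomial.X (p.1, p.2 + 1))

/-- The evolutionary vector field `D_F = ∑ D^k(F^i) ∂/∂u^i_k` of the evolution system
`u^i_t = F^i`. -/
def evolutionary {ι K : Type*} [Field K] (F : ι → DiffPoly ι K) :
    Derivation K (DiffPoly ι K) (DiffPoly ι K) :=
  MvPolynomial.mkDerivation K (fun p : ι × ℕ => (totalD ι K)^[p.2] (F p.1))

/-- Compatibility of `u^i_t = F^i` and `u^i_τ = G^i`: the vector fields `D_F` and `D_G`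
commute. -/
def Compatible {ι K : Type*} [Field K] (F G : ι → DiffPoly ι K) : Prop :=
  ⁅evolutionary F, evolutionary G⁆ = 0

variable {ι K V : Type*} [Fintype ι] [Field K] [AddCommGroup V] [Module K V]

/-- A triple system, evaluated on vectors whose components with respect to the basis `b` are
differential polynomials:
`T(X,Y,Z)^i = ∑ T^i_{jkm} X^j Y^k Z^m` with the structure constants `T^i_{jkm}`. -/
def apply3 (b : Basis ι K V) (T : TripleSystem K V) (X Y Z : ι → DiffPoly ι K) :
    ι → DiffPoly ι K :=
  fun i => ∑ j, ∑ k, ∑ m,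
    MvPolynomial.C (b.repr (T (b j) (b k) (b m)) i) * (X j * Y k * Z m)

/-- A 5-system, evaluated on vectors whose components with respect to the basis `b` are
differential polynomials. -/
def apply5 (b : Basis ι K V) (C : FiveSystem K V) (X Y Z S T : ι → DiffPoly ι K) :
    ι → DiffPoly ι K :=
  fun i => ∑ j, ∑ k, ∑ m, ∑ p, ∑ q,
    MvPolynomial.C (b.repr (C (b j) (b k) (b m) (b p) (b q)) i) *
      (X j * Y k * Z m * S p * T q)

/-- The right-hand side of `U_t = U_xxx + 3 B(U, U_x, U)`. -/
def mkdvRHS (b : Basis ι K V) (B : TripleSystem K V) : ι → DiffPoly ι K :=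
  U ι K 3 + (3 : K) • apply3 b B (U ι K 0) (U ι K 1) (U ι K 0)

/-- The right-hand side of
`U_τ = U_5 + 5 B₁(U,U,U_3) + 5 B₂(U,U_1,U_2) + 5 B₃(U_1,U_1,U_1) + 5 C(U,U,U,U,U_1)`. -/
def symmetryRHS (b : Basis ι K V) (B₁ B₂ B₃ : TripleSystem K V) (C : FiveSystem K V) :
    ι → DiffPoly ι K :=
  U ι K 5 + (5 : K) • apply3 b B₁ (U ι K 0) (U ι K 0) (U ι K 3)
    + (5 : K) • apply3 b B₂ (U ι K 0) (U ι K 1) (U ι K 2)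
    + (5 : K) • apply3 b B₃ (U ι K 1) (U ι K 1) (U ι K 1)
    + (5 : K) • apply5 b C (U ι K 0) (U ι K 0) (U ι K 0) (U ι K 0) (U ι K 1)

/-- The system with right-hand side `symmetryRHS b B₁ B₂ B₃ C` is a symmetry of
`U_t = U_xxx + 3 B(U, U_x, U)`. -/
def IsFifthOrderSymmetry (b : Basis ι K V) (B B₁ B₂ B₃ : TripleSystem K V)
    (C : FiveSystem K V) : Prop :=
  Compatible (mkdvRHS b B) (symmetryRHS b B₁ B₂ B₃ C)

/-- `U_t = U_xxx + 3 B(U, U_x, U)` has a fifth-order symmetry of the above form. -/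
def HasFifthOrderSymmetry (b : Basis ι K V) (B : TripleSystem K V) : Prop :=
  ∃ (B₁ B₂ B₃ : TripleSystem K V) (C : FiveSystem K V), IsFifthOrderSymmetry b B B₁ B₂ B₃ C

end

end DiffPoly

/-!
The symmetry condition is an identity between vectors of differential polynomials. As evolutionary
vector fields commute with the total derivative `D`, it says `D_F(G) = D_G(F)`
(`DiffPoly.compatible_iff`), and as `K` is infinite it may be tested on values: substituting an
arbitrary jet `v : ℕ → V` for `(U_k)_k` turns it into `DiffPoly.defect B B₁ B₂ B₃ C v = 0` for all
`v`, a statement about multilinear operations on `V` alone (`DiffPoly.isFifthOrderSymmetry_iff`).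

The defect has components of degree three, five and seven. Evaluating it at jets with few nonzero
entries, the component of degree three forces `B₁`, `B₂`, `B₃` to be the expressions in `B` of the
theorem, and the terms of type `U_0³ U_1 U_3` in the component of degree five force the same for `C`,
as far as these operations enter the right-hand side of the symmetry. For these canonical coefficients the
component of degree three vanishes and the other two are explicit
(`DiffPoly.defect_canonical`).

It remains to compare the canonical defect with the Jordan identity. An outer symmetric `B` is
`T(x, z, y) + T(z, x, y)` for a unique outer symmetric `T`, namely
`T(x, y, z) = ½ (B(y, x, z) + B(x, z, y) - B(x, y, z))`. The parts of the defect of type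
`U_0³ U_1 U_3` and `U_0² U_1² U_2`, polarized, together generate the Jordan identity of `T` under
permutations of the variables (`DiffPoly.isJordanTriple_jordanOf`). Conversely the
component of degree five is a linear combination of instances of the Jordan identity, and so is the
one of degree seven, if the identity is also used with a product substituted for one of its
variables and inside a further product (`DiffPoly.quinticDefect_eq_zero`,
`DiffPoly.septicDefect_eq_zero`). The coefficients of these combinations solve finite systems of
linear equations.
-/

namespace DiffPoly

/-! ### Values of differential polynomials at jets -/

open MvPolynomial

section Jets

variable {ι K V : Type*} [Field K] [AddCommGroup V] [Module K V]

/-- A derivation of the ring of differential polynomials, acting componentwise on vectors. -/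
noncomputable def vec (δ : Derivation K (DiffPoly ι K) (DiffPoly ι K)) :
    (ι → DiffPoly ι K) →ₗ[K] (ι → DiffPoly ι K) :=
  (δ : DiffPoly ι K →ₗ[K] DiffPoly ι K).compLeft ι

lemma vec_apply (δ : Derivation K (DiffPoly ι K) (DiffPoly ι K)) (X : ι → DiffPoly ι K) (i : ι) :
    vec δ X i = δ (X i) := rfl

lemma vec_iterate_smul (δ : Derivation K (DiffPoly ι K) (DiffPoly ι K)) (n : ℕ) (c : K)
    (X : ι → DiffPoly ι K) : (vec δ)^[n] (c • X) = c • (vec δ)^[n] X := by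
  rw [← Module.End.coe_pow, map_smul]

lemma vec_U (F : ι → DiffPoly ι K) (k : ℕ) :
    vec (evolutionary F) (U ι K k) = (vec (totalD ι K))^[k] F := by
  funext i
  have : ((vec (totalD ι K))^[k] F) i = (totalD ι K)^[k] (F i) := by
    induction k generalizing F with
    | zero => rfl
    | succ k ih => rw [Function.iterate_succ_apply, ih, Function.iterate_succ_apply]; rfl
  rw [this, vec_apply, U, evolutionary, mkDerivation_X]

lemma vec_totalD_U (k : ℕ) : vec (totalD ι K) (U ι K k) = U ι K (k + 1) := by
  funext i
  simp [vec_apply, U, totalD]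

lemma commute_totalD_evolutionary (F : ι → DiffPoly ι K) (P : DiffPoly ι K) :
    evolutionary F (totalD ι K P) = totalD ι K (evolutionary F P) := by
  have : ⁅evolutionary F, totalD ι K⁆ = 0 := by
    refine MvPolynomial.derivation_ext fun p => ?_
    simp [Derivation.commutator_apply, totalD, evolutionary, Function.iterate_succ_apply']
  have h := congrArg (fun δ => δ P) this
  simpa [Derivation.commutator_apply, sub_eq_zero] using h

/-- Evolutionary vector fields commute with `totalD`, so only their action on `U_0` has to be
compared. -/
lemma compatible_iff (F G : ι → DiffPoly ι K) :
    Compatible F G ↔ vec (evolutionary F) G = vec (evolutionary G) F := by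
  have key : ∀ (F G : ι → DiffPoly ι K) (k : ℕ) (i : ι),
      evolutionary F ((totalD ι K)^[k] (G i)) = (totalD ι K)^[k] (evolutionary F (G i)) := by
    intro F G k i
    induction k with
    | zero => rfl
    | succ k ih =>
      rw [Function.iterate_succ_apply', commute_totalD_evolutionary, ih,
        Function.iterate_succ_apply']
  have val : ∀ (F : ι → DiffPoly ι K) (i : ι) (k : ℕ),
      evolutionary F (X (i, k)) = (totalD ι K)^[k] (F i) := fun F i k => by
    rw [evolutionary, mkDerivation_X]
  constructor
  · intro h
    funext i
    have h := congrArg (fun δ => δ (X (i, 0))) h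
    simpa [Derivation.commutator_apply, val, sub_eq_zero, vec_apply] using h
  · intro h
    refine MvPolynomial.derivation_ext fun p => ?_
    have h : evolutionary F (G p.1) = evolutionary G (F p.1) := congrFun h p.1
    rw [Derivation.commutator_apply, val F p.1 p.2, val G p.1 p.2, key, key, h, sub_self]
    rfl

variable [Fintype ι]

/-- The value of a vector of differential polynomials at the jet `v`, that is, its value after the
substitution `U_k ↦ v k`. -/
noncomputable def jetEval (b : Basis ι K V) (v : ℕ → V) : (ι → DiffPoly ι K) →ₗ[K] V :=
  (b.equivFun.symm : (ι → K) →ₗ[K] V) ∘ₗ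
    ((aeval fun p : ι × ℕ => b.repr (v p.2) p.1 : DiffPoly ι K →ₐ[K] K).toLinearMap.compLeft ι)

lemma jetEval_repr (b : Basis ι K V) (v : ℕ → V) (X : ι → DiffPoly ι K) (i : ι) :
    b.repr (jetEval b v X) i = aeval (fun p : ι × ℕ => b.repr (v p.2) p.1) (X i) := by
  rw [← b.equivFun_apply]
  simp only [jetEval, LinearMap.comp_apply, LinearEquiv.coe_coe, LinearEquiv.apply_symm_apply]
  rfl

/-- Since `K` is infinite, a vector of differential polynomials is determined by its values. -/
lemma eq_zero_of_jetEval [CharZero K] (b : Basis ι K V) {X : ι → DiffPoly ι K}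
    (h : ∀ v, jetEval b v X = 0) : X = 0 := by
  funext i
  refine MvPolynomial.funext fun p => ?_
  have := jetEval_repr b (fun k => b.equivFun.symm fun j => p (j, k)) X i
  rw [h] at this
  simp only [map_zero, Finsupp.coe_zero, Pi.zero_apply] at this ⊢
  rw [this, ← coe_aeval_eq_eval]
  simp only [RingHom.coe_coe]
  congr 2
  funext q
  rw [← b.equivFun_apply, LinearEquiv.apply_symm_apply]

lemma jetEval_U (b : Basis ι K V) (v : ℕ → V) (k : ℕ) : jetEval b v (U ι K k) = v k := by
  refine b.ext_elem fun i => ?_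
  rw [jetEval_repr]
  simp [U]

lemma sum_repr_smul_map {M : Type*} [AddCommMonoid M] [Module K M] (b : Basis ι K V)
    (f : V →ₗ[K] M) (x : V) : f x = ∑ j, b.repr x j • f (b j) := by
  conv_lhs => rw [← b.sum_repr x]
  simp only [map_sum, map_smul]

lemma apply_eq_sum_basis (b : Basis ι K V) (T : TripleSystem K V) (x y z : V) :
    T x y z = ∑ j, ∑ k, ∑ m, (b.repr x j * b.repr y k * b.repr z m) • T (b j) (b k) (b m) := by
  rw [sum_repr_smul_map b T x, LinearMap.sum_apply, LinearMap.sum_apply]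
  refine Finset.sum_congr rfl fun j _ => ?_
  rw [LinearMap.smul_apply, LinearMap.smul_apply, sum_repr_smul_map b (T (b j)) y,
    LinearMap.sum_apply, Finset.smul_sum]
  refine Finset.sum_congr rfl fun k _ => ?_
  rw [LinearMap.smul_apply, sum_repr_smul_map b (T (b j) (b k)) z, Finset.smul_sum,
    Finset.smul_sum]
  refine Finset.sum_congr rfl fun m _ => ?_
  module

lemma jetEval_apply3 (b : Basis ι K V) (v : ℕ → V) (T : TripleSystem K V)
    (X Y Z : ι → DiffPoly ι K) :
    jetEval b v (apply3 b T X Y Z) = T (jetEval b v X) (jetEval b v Y) (jetEval b v Z) := by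
  refine b.ext_elem fun i => ?_
  rw [jetEval_repr, apply_eq_sum_basis b T]
  simp only [jetEval_repr, apply3, map_sum, map_mul, aeval_C, map_smul, Finsupp.coe_finsetSum,
    Finset.sum_apply, Finsupp.smul_apply, smul_eq_mul, Algebra.algebraMap_self, RingHom.id_apply]
  simp only [mul_comm]

lemma jetEval_apply5 (b : Basis ι K V) (v : ℕ → V) (C : FiveSystem K V)
    (X Y Z S T : ι → DiffPoly ι K) :
    jetEval b v (apply5 b C X Y Z S T) =
      C (jetEval b v X) (jetEval b v Y) (jetEval b v Z) (jetEval b v S) (jetEval b v T) := by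
  refine b.ext_elem fun i => ?_
  rw [jetEval_repr, sum_repr_smul_map b C (jetEval b v X)]
  simp only [LinearMap.sum_apply, LinearMap.smul_apply]
  conv_rhs =>
    enter [1, 2, 2, j, 2]
    rw [sum_repr_smul_map b (C (b j)) (jetEval b v Y)]
  simp only [LinearMap.sum_apply, LinearMap.smul_apply]
  conv_rhs =>
    enter [1, 2, 2, j, 2, 2, k, 2]
    rw [apply_eq_sum_basis b (C (b j) (b k))]
  simp only [jetEval_repr, apply5, map_sum, map_mul, aeval_C, map_smul, Finsupp.coe_finsetSum,
    Finset.sum_apply, Finsupp.smul_apply, smul_eq_mul, Algebra.algebraMap_self, RingHom.id_apply,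
    Finset.mul_sum]
  refine Finset.sum_congr rfl fun j _ => Finset.sum_congr rfl fun k _ =>
    Finset.sum_congr rfl fun m _ => Finset.sum_congr rfl fun p _ =>
    Finset.sum_congr rfl fun q _ => ?_
  ring

lemma vec_apply3 (b : Basis ι K V) (δ : Derivation K (DiffPoly ι K) (DiffPoly ι K))
    (T : TripleSystem K V) (X Y Z : ι → DiffPoly ι K) :
    vec δ (apply3 b T X Y Z) =
      apply3 b T (vec δ X) Y Z + apply3 b T X (vec δ Y) Z + apply3 b T X Y (vec δ Z) := by
  funext i
  simp only [vec_apply, apply3, Pi.add_apply, map_sum, ← Finset.sum_add_distrib]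
  refine Finset.sum_congr rfl fun j _ => Finset.sum_congr rfl fun k _ =>
    Finset.sum_congr rfl fun m _ => ?_
  simp only [Derivation.leibniz, derivation_C, smul_eq_mul]
  ring

lemma vec_apply5 (b : Basis ι K V) (δ : Derivation K (DiffPoly ι K) (DiffPoly ι K))
    (C : FiveSystem K V) (X Y Z S T : ι → DiffPoly ι K) :
    vec δ (apply5 b C X Y Z S T) =
      apply5 b C (vec δ X) Y Z S T + apply5 b C X (vec δ Y) Z S T + apply5 b C X Y (vec δ Z) S T
        + apply5 b C X Y Z (vec δ S) T + apply5 b C X Y Z S (vec δ T) := by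
  funext i
  simp only [vec_apply, apply5, Pi.add_apply, map_sum, ← Finset.sum_add_distrib]
  refine Finset.sum_congr rfl fun j _ => Finset.sum_congr rfl fun k _ =>
    Finset.sum_congr rfl fun m _ => Finset.sum_congr rfl fun p _ =>
    Finset.sum_congr rfl fun q _ => ?_
  simp only [Derivation.leibniz, derivation_C, smul_eq_mul]
  ring

end Jets

/-! ### The defect of commutativity -/

section Defect

variable {ι K V : Type*} [Fintype ι] [Field K] [AddCommGroup V] [Module K V]

/-- The value at the jet `v` of the `n`-th total derivative of `T(U_i, U_j, U_k)`. -/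
def leibniz3 (T : TripleSystem K V) (v : ℕ → V) : ℕ → ℕ → ℕ → ℕ → V
  | 0, i, j, k => T (v i) (v j) (v k)
  | n + 1, i, j, k =>
    leibniz3 T v n (i + 1) j k + leibniz3 T v n i (j + 1) k + leibniz3 T v n i j (k + 1)

/-- The value at the jet `v` of the `n`-th total derivative of `C(U_i, U_j, U_k, U_l, U_m)`. -/
def leibniz5 (C : FiveSystem K V) (v : ℕ → V) : ℕ → ℕ → ℕ → ℕ → ℕ → ℕ → V
  | 0, i, j, k, l, m => C (v i) (v j) (v k) (v l) (v m)
  | n + 1, i, j, k, l, m =>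
    leibniz5 C v n (i + 1) j k l m + leibniz5 C v n i (j + 1) k l m
      + leibniz5 C v n i j (k + 1) l m + leibniz5 C v n i j k (l + 1) m
      + leibniz5 C v n i j k l (m + 1)

lemma jetEval_iterate_U (b : Basis ι K V) (v : ℕ → V) (n k : ℕ) :
    jetEval b v ((vec (totalD ι K))^[n] (U ι K k)) = v (k + n) := by
  induction n generalizing k with
  | zero => exact jetEval_U b v k
  | succ n ih =>
    rw [Function.iterate_succ_apply, vec_totalD_U, ih, Nat.add_right_comm, Nat.add_assoc]

lemma jetEval_iterate_apply3 (b : Basis ι K V) (T : TripleSystem K V) (v : ℕ → V)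
    (n i j k : ℕ) :
    jetEval b v ((vec (totalD ι K))^[n] (apply3 b T (U ι K i) (U ι K j) (U ι K k))) =
      leibniz3 T v n i j k := by
  induction n generalizing i j k with
  | zero => simp only [Function.iterate_zero, id, jetEval_apply3, jetEval_U, leibniz3]
  | succ n ih =>
    rw [Function.iterate_succ_apply, vec_apply3, iterate_map_add, iterate_map_add]
    simp only [vec_totalD_U, map_add, ih, leibniz3]

lemma jetEval_iterate_apply5 (b : Basis ι K V) (C : FiveSystem K V) (v : ℕ → V)
    (n i j k l m : ℕ) :
    jetEval b v ((vec (totalD ι K))^[n]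
        (apply5 b C (U ι K i) (U ι K j) (U ι K k) (U ι K l) (U ι K m))) =
      leibniz5 C v n i j k l m := by
  induction n generalizing i j k l m with
  | zero => simp only [Function.iterate_zero, id, jetEval_apply5, jetEval_U, leibniz5]
  | succ n ih =>
    rw [Function.iterate_succ_apply, vec_apply5, iterate_map_add, iterate_map_add,
      iterate_map_add, iterate_map_add]
    simp only [vec_totalD_U, map_add, ih, leibniz5]

/-- The value at the jet `v` of the `n`-th total derivative of `mkdvRHS`. -/
def mkdvJet (B : TripleSystem K V) (v : ℕ → V) (n : ℕ) : V :=
  v (3 + n) + (3 : K) • leibniz3 B v n 0 1 0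

/-- The value at the jet `v` of the `n`-th total derivative of `symmetryRHS`. -/
def symmetryJet (B₁ B₂ B₃ : TripleSystem K V) (C : FiveSystem K V) (v : ℕ → V) (n : ℕ) : V :=
  v (5 + n) + (5 : K) • leibniz3 B₁ v n 0 0 3 + (5 : K) • leibniz3 B₂ v n 0 1 2
    + (5 : K) • leibniz3 B₃ v n 1 1 1 + (5 : K) • leibniz5 C v n 0 0 0 0 1

/-- The value at the jet `v` of `D_F(G) - D_G(F)`, where `F = mkdvRHS` and `G = symmetryRHS`. -/
def defect (B B₁ B₂ B₃ : TripleSystem K V) (C : FiveSystem K V) (v : ℕ → V) : V :=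
  mkdvJet B v 5
    + (5 : K) • (B₁ (mkdvJet B v 0) (v 0) (v 3) + B₁ (v 0) (mkdvJet B v 0) (v 3)
      + B₁ (v 0) (v 0) (mkdvJet B v 3))
    + (5 : K) • (B₂ (mkdvJet B v 0) (v 1) (v 2) + B₂ (v 0) (mkdvJet B v 1) (v 2)
      + B₂ (v 0) (v 1) (mkdvJet B v 2))
    + (5 : K) • (B₃ (mkdvJet B v 1) (v 1) (v 1) + B₃ (v 1) (mkdvJet B v 1) (v 1)
      + B₃ (v 1) (v 1) (mkdvJet B v 1))
    + (5 : K) • (C (mkdvJet B v 0) (v 0) (v 0) (v 0) (v 1)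
      + C (v 0) (mkdvJet B v 0) (v 0) (v 0) (v 1) + C (v 0) (v 0) (mkdvJet B v 0) (v 0) (v 1)
      + C (v 0) (v 0) (v 0) (mkdvJet B v 0) (v 1) + C (v 0) (v 0) (v 0) (v 0) (mkdvJet B v 1))
    - (symmetryJet B₁ B₂ B₃ C v 3
      + (3 : K) • (B (symmetryJet B₁ B₂ B₃ C v 0) (v 1) (v 0)
        + B (v 0) (symmetryJet B₁ B₂ B₃ C v 1) (v 0)
        + B (v 0) (v 1) (symmetryJet B₁ B₂ B₃ C v 0)))

lemma jetEval_iterate_mkdvRHS (b : Basis ι K V) (B : TripleSystem K V) (v : ℕ → V) (n : ℕ) :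
    jetEval b v ((vec (totalD ι K))^[n] (mkdvRHS b B)) = mkdvJet B v n := by
  simp only [mkdvRHS, mkdvJet, iterate_map_add, vec_iterate_smul, map_add, map_smul,
    jetEval_iterate_U, jetEval_iterate_apply3]

lemma jetEval_iterate_symmetryRHS (b : Basis ι K V) (B₁ B₂ B₃ : TripleSystem K V)
    (C : FiveSystem K V) (v : ℕ → V) (n : ℕ) :
    jetEval b v ((vec (totalD ι K))^[n] (symmetryRHS b B₁ B₂ B₃ C)) =
      symmetryJet B₁ B₂ B₃ C v n := by
  simp only [symmetryRHS, symmetryJet, iterate_map_add, vec_iterate_smul, map_add, map_smul,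
    jetEval_iterate_U, jetEval_iterate_apply3, jetEval_iterate_apply5]

/-- The symmetry condition, tested on jets. -/
lemma isFifthOrderSymmetry_iff [CharZero K] (b : Basis ι K V) (B B₁ B₂ B₃ : TripleSystem K V)
    (C : FiveSystem K V) :
    IsFifthOrderSymmetry b B B₁ B₂ B₃ C ↔ ∀ v, defect B B₁ B₂ B₃ C v = 0 := by
  have key : ∀ v, jetEval b v (vec (evolutionary (mkdvRHS b B)) (symmetryRHS b B₁ B₂ B₃ C)
      - vec (evolutionary (symmetryRHS b B₁ B₂ B₃ C)) (mkdvRHS b B)) =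
        defect B B₁ B₂ B₃ C v := fun v => by
    -- Only the outer occurrences are unfolded: those inside `evolutionary` are kept for the lemmas
    -- on their jets.
    conv_lhs =>
      enter [2]
      congr
      · enter [2]
        rw [symmetryRHS]
      · enter [2]
        rw [mkdvRHS]
    simp only [map_sub, map_add, map_smul, vec_apply3, vec_apply5, vec_U, jetEval_apply3,
      jetEval_apply5, jetEval_iterate_mkdvRHS, jetEval_iterate_symmetryRHS, jetEval_U, defect]
  rw [IsFifthOrderSymmetry, compatible_iff, ← sub_eq_zero]
  constructor
  · intro h v
    rw [← key, h, map_zero]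
  · intro h
    exact eq_zero_of_jetEval b fun v => by rw [key, h]

/-- The right-hand side of the system only involves `B` through `B(x, y, x)`. -/
lemma mkdvRHS_congr [CharZero K] (b : Basis ι K V) {B B' : TripleSystem K V}
    (h : ∀ x y, B x y x = B' x y x) : mkdvRHS b B = mkdvRHS b B' := by
  rw [← sub_eq_zero]
  refine eq_zero_of_jetEval b fun v => ?_
  simp only [mkdvRHS, map_sub, map_add, map_smul, jetEval_apply3, h, sub_self]

/-- The part of the coefficients that enters the right-hand side of the symmetry: symmetric
arguments may be identified, since they are always evaluated at the same `U_k`. -/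
lemma symmetryRHS_congr [CharZero K] (b : Basis ι K V) {B₁ B₂ B₃ B₁' B₂' B₃' : TripleSystem K V}
    {C C' : FiveSystem K V} (h₁ : ∀ x y, B₁ x x y = B₁' x x y)
    (h₂ : ∀ x y z, B₂ x y z = B₂' x y z) (h₃ : ∀ x, B₃ x x x = B₃' x x x)
    (hC : ∀ x y, C x x x x y = C' x x x x y) :
    symmetryRHS b B₁ B₂ B₃ C = symmetryRHS b B₁' B₂' B₃' C' := by
  rw [← sub_eq_zero]
  refine eq_zero_of_jetEval b fun v => ?_
  simp only [symmetryRHS, map_sub, map_add, map_smul, jetEval_apply3, jetEval_apply5, h₁, h₂, h₃,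
    hC, sub_self]

/-- The triple system `(x, y, z) ↦ B(x, z, y)`, the canonical choice of `B₁`. -/
def canonicalB₁ (B : TripleSystem K V) : TripleSystem K V :=
  LinearMap.lflip.toLinearMap ∘ₗ B

/-- The 5-system `(x, y, z, s, t) ↦ B(x, B(y, t, z), s) + ½ B(x, t, B(y, z, s))`, the canonical
choice of `C`. -/
def canonicalC (B : TripleSystem K V) : FiveSystem K V :=
  LinearMap.mk₂ K (fun x y => LinearMap.mk₂ K
    (fun z s => (B x).flip s ∘ₗ (B y).flip z + (1 / 2 : K) • (B x).flip (B y z s))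
    (fun z z' s => by ext t; simp; abel) (fun c z s => by ext t; simp; module)
    (fun z s s' => by ext t; simp; abel) (fun c z s => by ext t; simp; module))
    (fun x x' y => by ext; simp; abel) (fun c x y => by ext; simp; module)
    (fun x y y' => by ext; simp; abel) (fun c x y => by ext; simp; module)

lemma canonicalB₁_apply (B : TripleSystem K V) (x y z : V) : canonicalB₁ B x y z = B x z y := rfl

lemma canonicalC_apply (B : TripleSystem K V) (x y z s t : V) :
    canonicalC B x y z s t = B x (B y t z) s + (1 / 2 : K) • B x t (B y z s) := rfl

end Defect

/-! ### The defect for the canonical coefficients -/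

section Canonical

variable {K V : Type*} [Field K] [AddCommGroup V] [Module K V]

/-- The part of degree five of the defect for the canonical coefficients; `x, y, z, w` stand for
`U_0, U_1, U_2, U_3`. The four summands are those of type `U_0³ U_1 U_3`, `U_0³ U_2²`,
`U_0² U_1² U_2` and `U_0 U_1⁴`. -/
def quinticDefect (B : TripleSystem K V) (x y z w : V) : V :=
  (15 / 2 : K) • ((3 : K) • B x w (B x y x) - B y w (B x x x) - (2 : K) • B x w (B x x y))
  + (15 / 2 : K) • ((3 : K) • B x z (B x z x) - B z z (B x x x) - (2 : K) • B x z (B x x z))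
  + (15 / 2 : K) • ((2 : K) • B x (B y z y) x + (3 : K) • B z y (B x y x)
    + (6 : K) • B x y (B x z y) + (2 : K) • B y z (B x y x) + (4 : K) • B x z (B x y y)
    + (3 : K) • B y y (B x z x) - (2 : K) • B y (B x z x) y - (4 : K) • B y (B x y x) z
    - (2 : K) • B z y (B x x y) - (4 : K) • B y z (B x x y) - (2 : K) • B y y (B x x z)
    - (2 : K) • B x z (B y x y) - (2 : K) • B x y (B y x z) - (2 : K) • B x y (B x y z))
  + (15 : K) • (B x y (B y y y) + (2 : K) • B y y (B x y y) - (2 : K) • B y (B x y y) y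
    - B y y (B y x y))

/-- The part of degree seven of the defect for the canonical coefficients; `x, y, z` stand for
`U_0, U_1, U_2`. The two summands are those of type `U_0⁶ U_2` and `U_0⁵ U_1²`. -/
def septicDefect (B : TripleSystem K V) (x y z : V) : V :=
  (15 / 2 : K) • (B x (B x z x) (B x x x) - B x (B x z (B x x x)) x)
  + (15 / 2 : K) • ((4 : K) • B x (B x y x) (B x y x) + (3 : K) • B x (B x y (B x y x)) x
    + B (B x x x) y (B x y x) + (2 : K) • B x (B x y y) (B x x x)
    + (2 : K) • B x y (B x x (B x y x)) - (3 : K) • B x y (B x (B x y x) x)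
    - (2 : K) • B x y (B x y (B x x x)) - (4 : K) • B x (B x (B x y x) y) x
    - B x (B y y (B x x x)) x - (2 : K) • B x (B x y (B x x y)) x)

set_option maxHeartbeats 4000000 in
/-- The part of degree three cancels for the canonical coefficients. -/
lemma defect_canonical [CharZero K] {B : TripleSystem K V} (hB : IsOuterSymmetric B) (v : ℕ → V) :
    defect B (canonicalB₁ B) ((2 : K) • B + (2 : K) • canonicalB₁ B) B (canonicalC B) v =
      quinticDefect B (v 0) (v 1) (v 2) (v 3) + septicDefect B (v 0) (v 1) (v 2) := by
  have hB' : ∀ x y z, B x y z = B z y x := hB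
  -- `hB'` is a permutative rewrite rule, which brings all products into a normal form.
  simp only [defect, mkdvJet, symmetryJet, leibniz3, leibniz5, canonicalC_apply,
    canonicalB₁_apply, LinearMap.add_apply, LinearMap.smul_apply, map_add, map_smul, zero_add,
    Nat.reduceAdd, hB', quinticDefect, septicDefect]
  module

end Canonical

/-! ### The defect vanishes for Jordan triple systems -/

section Sufficiency

variable {K V : Type*} [Field K] [AddCommGroup V] [Module K V]

set_option maxHeartbeats 4000000 in
lemma quinticDefect_eq_zero [CharZero K] {B T : TripleSystem K V} (hT : IsJordanTriple T)
    (hB : ∀ x y z : V, B x y z = T x z y + T z x y) (x y z w : V) :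
    quinticDefect B x y z w = 0 := by
  have hs : ∀ x y z, T x y z = T z y x := hT.symm
  have hJ := hT.jordan
  simp only [quinticDefect, hB]
  -- One line of Jordan identities for each of the four types of terms in `quinticDefect`, except
  -- that the third type takes three lines.
  linear_combination (norm := skip)
    (15 : K) • (hJ x y w x x + hJ x x w y x - hJ y x w x x - hJ x x w x y)
    + (15 : K) • (hJ x x x z z + hJ x z x x z - hJ z x x x z - hJ x x z x z)
    + (15 : K) • ((2 : K) • hJ x x y y z - hJ z x y x y - (3 : K) • hJ y x y x z
      + (2 : K) • hJ x y x y z - (2 : K) • hJ z y x x y + hJ x y x z y + hJ x z x y y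
      + (2 : K) • hJ y x x z y + (2 : K) • hJ x z y x y)
    + (10 : K) • ((3 : K) • hJ x y y y y + (3 : K) • hJ y y x y y - hJ y y y x y + hJ y x y y y)
  simp only [map_add, LinearMap.add_apply, hs]
  module

set_option maxHeartbeats 4000000 in
lemma septicDefect_eq_zero [CharZero K] {B T : TripleSystem K V} (hT : IsJordanTriple T)
    (hB : ∀ x y z : V, B x y z = T x z y + T z x y) (x y z : V) :
    septicDefect B x y z = 0 := by
  have hs : ∀ x y z, T x y z = T z y x := hT.symm
  have hJ := hT.jordan
  -- The Jordan identity inside the first and the second argument of a further product.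
  have hO : ∀ x y u v z p q : V, T (T x y (T u v z)) p q - T (T (T x y u) v z) p q
      - T (T u v (T x y z)) p q + T (T u (T y x v) z) p q = 0 := fun x y u v z p q => by
    simpa only [map_add, map_sub, LinearMap.add_apply, LinearMap.sub_apply, map_zero,
      LinearMap.zero_apply] using congrArg (fun t => T t p q) (hJ x y u v z)
  have hM : ∀ x y u v z p q : V, T p (T x y (T u v z)) q - T p (T (T x y u) v z) q
      - T p (T u v (T x y z)) q + T p (T u (T y x v) z) q = 0 := fun x y u v z p q => by
    simpa only [map_add, map_sub, LinearMap.add_apply, LinearMap.sub_apply, map_zero,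
      LinearMap.zero_apply] using congrArg (fun t => T p t q) (hJ x y u v z)
  simp only [septicDefect, hB]
  linear_combination (norm := skip)
    (10 : K) • (hO x x x x z x x - hJ x x (T x x z) x x + (2 : K) • hJ z (T x x x) x x x
      - (2 : K) • hJ x x (T x x x) x z - (2 : K) • hJ z x x (T x x x) x
      + (2 : K) • hO x x x x x x z)
    + (10 : K) • (
      (9 : K) • hJ (T x x y) x x x y - (9 : K) • hJ x x x (T x x y) y
      - (6 : K) • hJ y x x (T x x x) y - (6 : K) • hJ y x x y (T x x x)
      - (6 : K) • hJ x y (T x x x) x y - (6 : K) • hJ (T x x x) y x x y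
      + (3 : K) • hJ x x (T x y y) x x + (3 : K) • hJ x (T x x y) x x y
      - (3 : K) • hJ x x (T x x y) x y - (3 : K) • hJ x x (T y x y) x x
      - (2 : K) • hJ x x x (T x y y) x + (2 : K) • hJ x (T x y y) x x x
      + (15 : K) • hO x x x y y x x + (6 : K) • hO y y x x x x x + (4 : K) • hO x x x y x x y
      - (3 : K) • hO y x x x y x x - (3 : K) • hO x x y x y x x + (3 : K) • hO x x x x y x y
      + (3 : K) • hO x y x x y x x + (2 : K) • hO x y x x x x y
      - (4 : K) • hM x x x y x x y - (2 : K) • hM x y x x x x y + (3 : K) • hM x x x x y x y)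
  simp only [map_add, LinearMap.add_apply, hs]
  module

end Sufficiency

/-! ### The defect generates the Jordan identity -/

section Necessity

variable {K V : Type*} [Field K] [AddCommGroup V] [Module K V]

/-- The outer symmetric triple system `T` with `B(x, y, z) = T(x, z, y) + T(z, x, y)`, for outer
symmetric `B`. -/
def jordanOf (B : TripleSystem K V) : TripleSystem K V :=
  (1 / 2 : K) • (B.flip + canonicalB₁ B - B)

lemma jordanOf_apply (B : TripleSystem K V) (x y z : V) :
    jordanOf B x y z = (1 / 2 : K) • (B y x z + B x z y - B x y z) := rfl

lemma eq_jordanOf_add [CharZero K] {B : TripleSystem K V} (hB : IsOuterSymmetric B) (x y z : V) :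
    B x y z = jordanOf B x z y + jordanOf B z x y := by
  rw [jordanOf_apply, jordanOf_apply, hB z x y, hB z y x, hB x z y]
  module

lemma isOuterSymmetric_jordanOf {B : TripleSystem K V} (hB : IsOuterSymmetric B) :
    IsOuterSymmetric (jordanOf B) := fun x y z => by
  rw [jordanOf_apply, jordanOf_apply, hB z y x, hB y z x, hB z x y]
  module

/-- A multilinear operation that becomes, for `x₁ = x₂ = x₃`, the part of `quinticDefect` of type
`U_0³ U_1 U_3`, up to a constant factor. -/
def cubicRelation (B : TripleSystem K V) (x₁ x₂ x₃ y w : V) : V :=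
  (3 : K) • B x₁ w (B x₂ y x₃) - B y w (B x₁ x₂ x₃) - (2 : K) • B x₁ w (B x₂ x₃ y)

/-- A multilinear operation that becomes, for `x = x'` and `y = y'`, the part of `quinticDefect` of
type `U_0² U_1² U_2`, up to a constant factor. -/
def quadraticRelation (B : TripleSystem K V) (x x' y y' z : V) : V :=
  (2 : K) • B x (B y z y') x' + (3 : K) • B z y (B x y' x')
    + (6 : K) • B x y (B x' z y') + (2 : K) • B y z (B x y' x') + (4 : K) • B x z (B x' y y')
    + (3 : K) • B y y' (B x z x') - (2 : K) • B y (B x z x') y' - (4 : K) • B y (B x y' x') z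
    - (2 : K) • B z y (B x x' y') - (4 : K) • B y z (B x x' y') - (2 : K) • B y y' (B x x' z)
    - (2 : K) • B x z (B y x' y') - (2 : K) • B x y (B y' x' z) - (2 : K) • B x y (B x' y' z)

set_option maxHeartbeats 4000000 in
lemma cubicRelation_polarized {B : TripleSystem K V} (h : ∀ x y w, cubicRelation B x x x y w = 0)
    (a b c y w : V) :
    cubicRelation B a b c y w + cubicRelation B a c b y w + cubicRelation B b a c y w
      + cubicRelation B b c a y w + cubicRelation B c a b y w + cubicRelation B c b a y w = 0 := by
  have h₁ := h (a + b + c) y w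
  have h₂ := h (a + b) y w
  have h₃ := h (a + c) y w
  have h₄ := h (b + c) y w
  have h₅ := h a y w
  have h₆ := h b y w
  have h₇ := h c y w
  simp only [cubicRelation, map_add, LinearMap.add_apply] at *
  linear_combination (norm := module) h₁ - h₂ - h₃ - h₄ + h₅ + h₆ + h₇

set_option maxHeartbeats 4000000 in
lemma quadraticRelation_polarized {B : TripleSystem K V}
    (h : ∀ x y z, quadraticRelation B x x y y z = 0) (a b c d z : V) :
    quadraticRelation B a b c d z + quadraticRelation B b a c d z + quadraticRelation B a b d c z
      + quadraticRelation B b a d c z = 0 := by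
  -- First polarize in the first pair of arguments, then in the second.
  have half : ∀ a b y, quadraticRelation B a b y y z + quadraticRelation B b a y y z = 0 := by
    intro a b y
    have h₁ := h (a + b) y z
    have h₂ := h a y z
    have h₃ := h b y z
    simp only [quadraticRelation, map_add, LinearMap.add_apply] at *
    linear_combination (norm := module) h₁ - h₂ - h₃
  have h₁ := half a b (c + d)
  have h₂ := half a b c
  have h₃ := half a b d
  simp only [quadraticRelation, map_add, LinearMap.add_apply] at h₁ h₂ h₃ ⊢
  linear_combination (norm := module) h₁ - h₂ - h₃

set_option maxHeartbeats 4000000 in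
/-- The Jordan identity of `jordanOf B` is a linear combination of fifteen permuted instances of the
two polarized relations. -/
lemma isJordanTriple_jordanOf [CharZero K] {B : TripleSystem K V} (hB : IsOuterSymmetric B)
    (h₁ : ∀ x y w, cubicRelation B x x x y w = 0)
    (h₂ : ∀ x y z, quadraticRelation B x x y y z = 0) :
    IsJordanTriple (jordanOf B) where
  symm := isOuterSymmetric_jordanOf hB
  jordan a b c d e := by
    have hs : ∀ x y z, B x y z = B z y x := hB
    have h₁ := cubicRelation_polarized h₁
    have h₂ := quadraticRelation_polarized h₂
    simp only [jordanOf_apply]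
    linear_combination (norm := skip)
      (1 / 16 : K) • (h₁ a c e d b - h₁ a b d e c - h₁ a b d c e - h₁ b c e d a)
      + (1 / 32 : K) • (h₁ c d e a b - h₁ c d e b a)
      + (1 / 32 : K) • (h₂ a b c d e - h₂ a b c e d + h₂ a b d e c - h₂ c d b e a + h₂ c d a e b
        + h₂ c e b d a - h₂ c e a d b - h₂ d e b c a + h₂ d e a c b)
    simp only [cubicRelation, quadraticRelation, map_add, map_sub, map_smul, LinearMap.add_apply,
      LinearMap.sub_apply, LinearMap.smul_apply, hs]
    module

end Necessity

/-! ### The coefficients of a symmetry -/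

section Coefficients

variable {K V : Type*} [Field K] [AddCommGroup V] [Module K V]

set_option maxHeartbeats 4000000 in
/-- For the jet with `U_0 = U_1 = x` and `U_5 = y`, the terms linear in `y` are of degree three. -/
lemma coefficient_B₁ [CharZero K] {B B₁ B₂ B₃ : TripleSystem K V} {C : FiveSystem K V}
    (hB : IsOuterSymmetric B) (h : ∀ v, defect B B₁ B₂ B₃ C v = 0) (x y : V) :
    B₁ x x y = B x y x := by
  have hs : ∀ x y z, B x y z = B z y x := hB
  have key : ∀ z, defect B B₁ B₂ B₃ C
    (fun n => if n = 0 then x else if n = 1 then x else if n = 5 then z else 0) = 0 := fun z => h _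
  have h₁ := key y
  have h₂ := key 0
  simp only [defect, mkdvJet, symmetryJet, leibniz3, leibniz5, reduceIte, Nat.reduceAdd,
    Nat.reduceEqDiff, OfNat.ofNat_ne_zero, one_ne_zero, OfNat.ofNat_ne_one, zero_add, zero_ne_one,
    add_zero, smul_zero, map_zero, map_add, map_smul, LinearMap.zero_apply, LinearMap.add_apply,
    LinearMap.smul_apply] at h₁ h₂
  linear_combination (norm := skip) (-1 / 30 : K) • (h₁ - h₂)
  simp only [hs]
  module

set_option maxHeartbeats 4000000 in
/-- The terms of type `U_0 U_2 U_4` are of degree three. -/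
lemma coefficient_B₂ [CharZero K] {B B₁ B₂ B₃ : TripleSystem K V} {C : FiveSystem K V}
    (hB : IsOuterSymmetric B) (hB₁ : ∀ x y, B₁ x x y = B x y x)
    (h : ∀ v, defect B B₁ B₂ B₃ C v = 0) (x y z : V) :
    B₂ x y z = (2 : K) • B x y z + (2 : K) • B x z y := by
  have hs : ∀ x y z, B x y z = B z y x := hB
  have hB₁' : B₁ x y z + B₁ y x z = (2 : K) • B x z y := by
    have := hB₁ (x + y) z
    simp only [map_add, LinearMap.add_apply, hB₁, hs y z x] at this
    linear_combination (norm := module) this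
  have key : ∀ y z, defect B B₁ B₂ B₃ C
    (fun n => if n = 0 then x else if n = 2 then y else if n = 4 then z else 0) = 0 :=
    fun y z => h _
  have h₁ := key y z
  have h₂ := key y 0
  have h₃ := key 0 z
  simp only [defect, mkdvJet, symmetryJet, leibniz3, leibniz5, reduceIte, Nat.reduceAdd,
    Nat.reduceEqDiff, OfNat.ofNat_ne_zero, one_ne_zero, zero_add, add_zero, smul_zero, map_zero,
    map_add, map_smul, LinearMap.zero_apply, LinearMap.add_apply, LinearMap.smul_apply]
    at h₁ h₂ h₃
  linear_combination (norm := skip) (-1 / 15 : K) • (h₁ - h₂ - h₃) - (1 : K) • hB₁'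
  simp only [hs]
  module

set_option maxHeartbeats 4000000 in
/-- For `U_0 = 0` only terms of degree three remain: in degrees five and seven the total order is
four and two, so every term has a factor `U_0`. -/
lemma coefficient_B₃ [CharZero K] {B B₁ B₂ B₃ : TripleSystem K V} {C : FiveSystem K V}
    (hB₁ : ∀ x y, B₁ x x y = B x y x)
    (hB₂ : ∀ x y z, B₂ x y z = (2 : K) • B x y z + (2 : K) • B x z y)
    (h : ∀ v, defect B B₁ B₂ B₃ C v = 0) (x : V) :
    B₃ x x x = B x x x := by
  have key : ∀ z, defect B B₁ B₂ B₃ C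
    (fun n => if n = 1 then x else if n = 2 then x else if n = 3 then z else 0) = 0 := fun z => h _
  have h₁ := key x
  have h₂ := key 0
  simp only [defect, mkdvJet, symmetryJet, leibniz3, leibniz5, reduceIte, Nat.reduceAdd,
    Nat.reduceEqDiff, OfNat.ofNat_ne_one, zero_add, zero_ne_one, add_zero, smul_zero, map_zero,
    map_add, map_smul, LinearMap.zero_apply, LinearMap.smul_apply, hB₁, hB₂] at h₁ h₂
  linear_combination (norm := skip) (-1 / 90 : K) • (h₁ - h₂)
  module

set_option maxHeartbeats 4000000 in
/-- For the jet with `U_0 = U_1 = x` and `U_3 = y`, the terms linear in `y` are those of type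
`U_0³ U_1 U_3`. -/
lemma coefficient_C [CharZero K] {B : TripleSystem K V} {C : FiveSystem K V}
    (hB : IsOuterSymmetric B)
    (h : ∀ v, defect B (canonicalB₁ B) ((2 : K) • B + (2 : K) • canonicalB₁ B) B C v = 0)
    (x y : V) : C x x x x y = B x (B x y x) x + (1 / 2 : K) • B x y (B x x x) := by
  have hs : ∀ x y z, B x y z = B z y x := hB
  have key : ∀ z, defect B (canonicalB₁ B) ((2 : K) • B + (2 : K) • canonicalB₁ B) B C
    (fun n => if n = 0 then x else if n = 1 then x else if n = 3 then z else 0) = 0 := fun z => h _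
  have h₁ := key y
  have h₂ := key 0
  simp only [defect, mkdvJet, symmetryJet, leibniz3, leibniz5, reduceIte, Nat.reduceAdd,
    Nat.reduceEqDiff, OfNat.ofNat_ne_zero, one_ne_zero, OfNat.ofNat_ne_one, zero_add, zero_ne_one,
    add_zero, smul_zero, map_zero, map_add, map_smul, LinearMap.zero_apply, LinearMap.add_apply,
    LinearMap.smul_apply, canonicalB₁_apply] at h₁ h₂
  linear_combination (norm := skip) (-1 / 60 : K) • (h₁ - h₂)
  simp only [hs]
  module

end Coefficients

/-! ### Characterization of the systems with a symmetry -/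

section Characterization

variable {ι K V : Type*} [Field K] [CharZero K] [AddCommGroup V] [Module K V]

lemma isJordanTriple_of_canonical {B : TripleSystem K V} (hB : IsOuterSymmetric B)
    (h : ∀ x y z w, quinticDefect B x y z w + septicDefect B x y z = 0) :
    IsJordanTriple (jordanOf B) := by
  refine isJordanTriple_jordanOf hB (fun x y w => ?_) (fun x y z => ?_)
  · have h₁ := h x y 0 w
    have h₂ := h x y 0 0
    simp only [quinticDefect, map_zero, LinearMap.zero_apply] at h₁ h₂
    rw [cubicRelation]
    linear_combination (norm := module) (2 / 15 : K) • (h₁ - h₂)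
  · have h₁ := h x y z 0
    have h₂ := h x y 0 0
    have h₃ := h x 0 z 0
    simp only [quinticDefect, septicDefect, map_zero, LinearMap.zero_apply] at h₁ h₂ h₃
    rw [quadraticRelation]
    linear_combination (norm := module) (2 / 15 : K) • (h₁ - h₂ - h₃)

variable [Fintype ι]

lemma isFifthOrderSymmetry_canonical_iff (b : Basis ι K V) {B : TripleSystem K V}
    (hB : IsOuterSymmetric B) :
    IsFifthOrderSymmetry b B (canonicalB₁ B) ((2 : K) • B + (2 : K) • canonicalB₁ B) B
        (canonicalC B) ↔
      ∃ T : TripleSystem K V, IsJordanTriple T ∧ ∀ x y z : V, B x y z = T x z y + T z x y := by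
  rw [isFifthOrderSymmetry_iff]
  simp only [defect_canonical hB]
  constructor
  · intro h
    refine ⟨jordanOf B, isJordanTriple_of_canonical hB fun x y z w => ?_, eq_jordanOf_add hB⟩
    exact h fun n => if n = 0 then x else if n = 1 then y else if n = 2 then z else w
  · rintro ⟨T, hT, hBT⟩ v
    rw [quinticDefect_eq_zero hT hBT, septicDefect_eq_zero hT hBT, add_zero]

lemma isFifthOrderSymmetry_iff_jordan (b : Basis ι K V) {B : TripleSystem K V}
    (hB : IsOuterSymmetric B) (B₁ B₂ B₃ : TripleSystem K V) (C : FiveSystem K V) :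
    IsFifthOrderSymmetry b B B₁ B₂ B₃ C ↔
      (∃ T : TripleSystem K V, IsJordanTriple T ∧ ∀ x y z : V, B x y z = T x z y + T z x y) ∧
      (∀ x y : V, B₁ x x y = B x y x) ∧
      (∀ x y z : V, B₂ x y z = (2 : K) • B x y z + (2 : K) • B x z y) ∧
      (∀ x : V, B₃ x x x = B x x x) ∧
      (∀ x y : V, C x x x x y = B x (B x y x) x + (1 / 2 : K) • B x y (B x x x)) := by
  have congr {C' : FiveSystem K V} (h₁ : ∀ x y, B₁ x x y = B x y x)
      (h₂ : ∀ x y z, B₂ x y z = (2 : K) • B x y z + (2 : K) • B x z y)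
      (h₃ : ∀ x, B₃ x x x = B x x x) (hC : ∀ x y, C x x x x y = C' x x x x y) :
      IsFifthOrderSymmetry b B B₁ B₂ B₃ C ↔ IsFifthOrderSymmetry b B (canonicalB₁ B)
        ((2 : K) • B + (2 : K) • canonicalB₁ B) B C' := by
    have : symmetryRHS b B₁ B₂ B₃ C = symmetryRHS b (canonicalB₁ B)
        ((2 : K) • B + (2 : K) • canonicalB₁ B) B C' := symmetryRHS_congr b h₁ h₂ h₃ hC
    rw [IsFifthOrderSymmetry, IsFifthOrderSymmetry, this]
  rw [← isFifthOrderSymmetry_canonical_iff b hB]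
  constructor
  · intro h
    have hd := (isFifthOrderSymmetry_iff b B B₁ B₂ B₃ C).1 h
    have h₁ := coefficient_B₁ hB hd
    have h₂ := coefficient_B₂ hB h₁ hd
    have h₃ := coefficient_B₃ h₁ h₂ hd
    have h₄ := coefficient_C hB
      ((isFifthOrderSymmetry_iff ..).1 ((congr h₁ h₂ h₃ fun _ _ => rfl).1 h))
    exact ⟨(congr (C' := canonicalC B) h₁ h₂ h₃ h₄).1 h, h₁, h₂, h₃, h₄⟩
  · rintro ⟨h, h₁, h₂, h₃, h₄⟩
    exact (congr (C' := canonicalC B) h₁ h₂ h₃ h₄).2 h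

lemma hasFifthOrderSymmetry_iff (b : Basis ι K V) {B : TripleSystem K V}
    (hB : IsOuterSymmetric B) :
    HasFifthOrderSymmetry b B ↔
      ∃ T : TripleSystem K V, IsJordanTriple T ∧ ∀ x y z : V, B x y z = T x z y + T z x y := by
  constructor
  · rintro ⟨B₁, B₂, B₃, C, h⟩
    exact ((isFifthOrderSymmetry_iff_jordan b hB B₁ B₂ B₃ C).1 h).1
  · intro h
    exact ⟨_, _, _, _, (isFifthOrderSymmetry_canonical_iff b hB).2 h⟩

lemma hasFifthOrderSymmetry_congr (b : Basis ι K V) {B B' : TripleSystem K V}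
    (h : ∀ x y, B x y x = B' x y x) : HasFifthOrderSymmetry b B ↔ HasFifthOrderSymmetry b B' := by
  simp only [HasFifthOrderSymmetry, IsFifthOrderSymmetry, mkdvRHS_congr b h]

end Characterization

section Polarization

variable {K V : Type*} [Field K] [AddCommGroup V] [Module K V]

/-- The triple system `B(x, y, z) = ½ (T(x, z, y) + T(z, x, y))`, obtained by polarizing
`B(x, y, x) = T(x, x, y)`. -/
def polarization (T : TripleSystem K V) : TripleSystem K V :=
  (1 / 2 : K) • canonicalB₁ (T + T.flip)

lemma polarization_apply (T : TripleSystem K V) (x y z : V) :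
    polarization T x y z = (1 / 2 : K) • (T x z y + T z x y) := rfl

lemma isOuterSymmetric_polarization (T : TripleSystem K V) :
    IsOuterSymmetric (polarization T) := fun x y z => by
  rw [polarization_apply, polarization_apply, add_comm]

lemma polarization_diagonal [CharZero K] (T : TripleSystem K V) (x y : V) :
    polarization T x y x = T x x y := by
  rw [polarization_apply]
  module

lemma eq_polarization [CharZero K] {B T : TripleSystem K V} (hB : IsOuterSymmetric B)
    (h : ∀ x y, B x y x = T x x y) : B = polarization T := by
  ext x y z
  have h₁ := h (x + z) y
  simp only [map_add, LinearMap.add_apply, h, hB z y x] at h₁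
  rw [polarization_apply]
  linear_combination (norm := module) (1 / 2 : K) • h₁

end Polarization

end DiffPoly

lemma IsJordanTriple.smul {K V : Type*} [Field K] [AddCommGroup V] [Module K V]
    {T : TripleSystem K V} (hT : IsJordanTriple T) (c : K) : IsJordanTriple (c • T) where
  symm x y z := by
    simp only [LinearMap.smul_apply, hT.symm x y z]
  jordan x y u v z := by
    simp only [LinearMap.smul_apply, map_smul]
    linear_combination (norm := module) (c * c) • hT.jordan x y u v z

theorem theorem2 {K V ι : Type*} [Field K] [CharZero K] [AddCommGroup V] [Module K V]
    [Fintype ι] (b : Module.Basis ι K V) :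
    -- existence of the symmetry characterizes Jordan triple systems
    (∀ B : TripleSystem K V, IsOuterSymmetric B →
      (DiffPoly.HasFifthOrderSymmetry b B ↔
        ∃ T : TripleSystem K V, IsJordanTriple T ∧
          ∀ x y z : V, B x y z = T x z y + T z x y)) ∧
    -- every Jordan triple system yields a system with a fifth-order symmetry
    (∀ T : TripleSystem K V, IsJordanTriple T →
      (∃! B : TripleSystem K V, IsOuterSymmetric B ∧ ∀ x y : V, B x y x = T x x y) ∧
      ∀ B : TripleSystem K V, (∀ x y : V, B x y x = T x x y) →
        DiffPoly.HasFifthOrderSymmetry b B) ∧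
    -- the coefficients of the symmetry are determined explicitly
    (∀ B : TripleSystem K V, IsOuterSymmetric B →
      ∀ (B₁ B₂ B₃ : TripleSystem K V) (C : FiveSystem K V),
        DiffPoly.IsFifthOrderSymmetry b B B₁ B₂ B₃ C ↔
          (∃ T : TripleSystem K V, IsJordanTriple T ∧
            ∀ x y z : V, B x y z = T x z y + T z x y) ∧
          (∀ x y : V, B₁ x x y = B x y x) ∧
          (∀ x y z : V, B₂ x y z = (2 : K) • B x y z + (2 : K) • B x z y) ∧
          (∀ x : V, B₃ x x x = B x x x) ∧
          (∀ x y : V, C x x x x y =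
            B x (B x y x) x + (1 / 2 : K) • B x y (B x x x))) := by
  refine ⟨fun B hB => DiffPoly.hasFifthOrderSymmetry_iff b hB, fun T hT => ⟨?_, fun B h => ?_⟩,
    fun B hB B₁ B₂ B₃ C => DiffPoly.isFifthOrderSymmetry_iff_jordan b hB B₁ B₂ B₃ C⟩
  · exact ⟨DiffPoly.polarization T, ⟨DiffPoly.isOuterSymmetric_polarization T,
      DiffPoly.polarization_diagonal T⟩, fun B hB => DiffPoly.eq_polarization hB.1 hB.2⟩
  · rw [DiffPoly.hasFifthOrderSymmetry_congr b
      fun x y => (h x y).trans (DiffPoly.polarization_diagonal T x y).symm,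
      DiffPoly.hasFifthOrderSymmetry_iff b (DiffPoly.isOuterSymmetric_polarization T)]
    refine ⟨(1 / 2 : K) • T, hT.smul _, fun x y z => ?_⟩
    rw [DiffPoly.polarization_apply, smul_add]
    rfl
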